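/- Let $m,l_1,k_1,l_2,k_2,d,e\ge 1$ be integers with $l_1\le k_1$ and $l_2\le k_2$, and put $n=l_1l_2d$, $N=k_1k_2e$; assume $N\ge 3m$. For matrices $B_1,\dots,B_k$ of equal size and $l\le k$, let $C_l(B_1,\dots,B_k)$ be the (truncated) circulant block matrix with $l$ block rows and $k$ block columns $$C_l(B_1,\dots,B_k)=\begin{pmatrix}B_k&B_{k-1}&\cdots&B_2&B_1\\ B_1&B_k&\cdots&B_3&B_2\\ \vdots&\vdots&\ddots&\ddots&\vdots\\ B_{l-1}&B_{l-2}&\cdots&\cdots&B_l\end{pmatrix},$$ whose block in position $(a,u)$ is $B_{a-u}$, the index being read modulo $k$. Let $\Upsilon^i_j\in\mathbb{R}^{d\times e}$ ($1\le i\le k_1$, $1\le j\le k_2$) be random matrices such that all entries of all the $\Upsilon^i_j$ are independent and identically distributed, with one of the following three distributions: $N(0,1/n)$; $\pm 1/\sqrt n$ with probability $1/2$ each; or $\pm\sqrt{3/n}$ with probability $1/6$ each and $0$ with probability $2/3$. Put $$\Phi_i=C_{l_2}(\Upsilon^i_1,\dots,\Upsilon^i_{k_2}),\qquad \Phi=C_{l_1}(\Phi_1,\dots,\Phi_{k_1})\in\mathbb{R}^{n\times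 N}.$$ A matrix $A\in\mathbb{R}^{n\times N}$ satisfies RIP of order $s$ and constant $\delta$ if $(1-\delta)\|z\|_2^2\le\|A_Tz\|_2^2\le(1+\delta)\|z\|_2^2$ for all $T\subset\{1,\dots,N\}$ with $|T|\le s$ and all $z\in\mathbb{R}^{|T|}$, where $A_T$ consists of the columns of $A$ indexed by $T$. For every $\delta\in(0,1)$ there are constants $c_1,c_2>0$, depending only on $\delta$, such that for all such $m,l_1,k_1,l_2,k_2,d,e$ and $\Phi$: (i) if $l_1l_2\le 3m(3m-1)$ and $n\ge c_1l_1l_2\,m\ln(N/m)$, then $\Phi$ satisfies RIP of order $3m$ and constant $\delta$ with probability at least $1-e^{-c_2n/(l_1l_2)}$; (ii) if $l_1l_2>3m(3m-1)$ and $n\ge c_1m^3\ln(N/m)$, then $\Phi$ satisfies RIP of order $3m$ and constant $\delta$ with probability at least $1-e^{-c_2n/m^2}$. -/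

import Mathlib

open MeasureTheory ProbabilityTheory
open scoped NNReal ENNReal

/-- The three admissible entry distributions. -/
inductive EntryDist
  | gaussian
  | bernoulli
  | ternary

/-- The law on `ℝ` of a single entry of a random matrix with `n` rows:
`N(0, 1/n)` (mean `0`, variance `1/n`), or `±1/√n` with probability `1/2` each, or
`±√(3/n)` with probability `1/6` each and `0` with probability `2/3`. -/
noncomputable def EntryDist.law (D : EntryDist) (n : ℕ) : Measure ℝ :=
  match D with
  | .gaussian => gaussianReal 0 (1 / (n : ℝ≥0))
  | .bernoulli =>
      (1 / 2 : ℝ≥0∞) • Measure.dirac (1 / √(n : ℝ)) +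
      (1 / 2 : ℝ≥0∞) • Measure.dirac (-(1 / √(n : ℝ)))
  | .ternary =>
      (1 / 6 : ℝ≥0∞) • Measure.dirac √(3 / (n : ℝ)) +
      (2 / 3 : ℝ≥0∞) • Measure.dirac 0 +
      (1 / 6 : ℝ≥0∞) • Measure.dirac (-√(3 / (n : ℝ)))

/-- The (truncated) circulant block matrix with `l` block rows and `k` block columns built from
blocks `B₁, …, B_k`, which are labelled by residues modulo `k` (so that `B_k = B₀`). Its block in
block row `a` and block column `u` (both counted from `0`) is `B_{a - u mod k}`: the first block
row is `B_k, B_{k-1}, …, B_1`, the second one `B_1, B_k, …, B_2`, and the `l`-th one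
`B_{l-1}, B_{l-2}, …, B_l`. -/
def circulantBlock (l k : ℕ) {ι κ : Type*} (B : ZMod k → Matrix ι κ ℝ) :
    Matrix (Fin l × ι) (Fin k × κ) ℝ :=
  Matrix.of fun r c => B (((r.1 : ℕ) : ZMod k) - ((c.1 : ℕ) : ZMod k)) r.2 c.2

/-- The restricted isometry property of order `s` and constant `δ`. Here
`A.submatrix id Subtype.val` is the matrix `A_T` of the columns of `A` indexed by `T`, and the
norms are Euclidean. -/
def SatisfiesRIP {ι κ : Type*} [Fintype ι] (A : Matrix ι κ ℝ) (s : ℕ) (δ : ℝ) : Prop :=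
  ∀ T : Finset κ, T.card ≤ s → ∀ z : EuclideanSpace ℝ T,
    (1 - δ) * ‖z‖ ^ 2 ≤
        ‖WithLp.toLp 2 ((A.submatrix id (Subtype.val : T → κ)).mulVec z.ofLp)‖ ^ 2 ∧
      ‖WithLp.toLp 2 ((A.submatrix id (Subtype.val : T → κ)).mulVec z.ofLp)‖ ^ 2 ≤
        (1 + δ) * ‖z‖ ^ 2

/-! Fix a set `T` of at most `3m` columns and a vector `z` on it. Then `‖Φ_T z‖²` has mean `‖z‖²`
and is a sum of squares of linear forms, one per row. No row repeats a variable, so each form,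
suitably normalised, is sub-Gaussian with unit variance and its centred square is sub-exponential
(`lintegral_exp_mul_sq_sub_one_le`).

Different rows may share variables. If the rows are coloured with `q` colours so that rows of one
colour share no variable on `T`, then the summands within a colour class are independent, and
Hölder's inequality across the classes gives a Bernstein bound with `n` replaced by `n / q`
(`lintegral_exp_sum_le_of_coloring`, `measure_abs_sum_ge_le_of_coloring`). Two colourings are
available: by block row, with `q = l₁l₂`, and a greedy one for the given `T`, with `q = 3m(3m - 1) +
1`. They yield the two regimes.

A union bound over `25^(3m)` net points and at most `(eN/3m)^(3m)` supports
(`measure_not_satisfiesRIP_le`) costs `exp(O(m log(N/m)))`, which is absorbed once `n / q` is a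
large multiple of `m log(N/m)`. -/

/-! ### Exponential moments of squares of sub-Gaussian variables -/

lemma lintegral_exp_sq_div_four_gaussianReal_le :
    ∫⁻ g, ENNReal.ofReal (Real.exp (g ^ 2 / 4)) ∂(gaussianReal 0 1) ≤ ENNReal.ofReal √2 := by
  rw [gaussianReal_of_var_ne_zero 0 one_ne_zero,
    lintegral_withDensity_eq_lintegral_mul _ (measurable_gaussianPDF 0 1) (by fun_prop)]
  have h : ∀ x : ℝ, (gaussianPDF 0 1 * fun g : ℝ => ENNReal.ofReal (Real.exp (g ^ 2 / 4))) x =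
      ENNReal.ofReal ((√(2 * Real.pi))⁻¹ * Real.exp (-(1 / 4) * x ^ 2)) := by
    intro x
    simp only [Pi.mul_apply, gaussianPDF]
    rw [← ENNReal.ofReal_mul (gaussianPDFReal_nonneg _ _ _), gaussianPDFReal, mul_assoc,
      ← Real.exp_add]
    congr 3
    · simp
    · simp; ring
  rw [lintegral_congr h, ← ofReal_integral_eq_lintegral_ofReal]
  · rw [integral_const_mul, integral_gaussian]
    apply ENNReal.ofReal_le_ofReal
    rw [← Real.sqrt_inv, ← Real.sqrt_mul (by positivity)]
    apply le_of_eq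
    congr 1
    field_simp
    norm_num
  · exact (integrable_exp_neg_mul_sq (by norm_num)).const_mul _
  · exact .of_forall fun x => by positivity

/-- A sub-Gaussian random variable has a finite exponential square moment. -/
lemma ProbabilityTheory.HasSubgaussianMGF.lintegral_exp_sq_le {Ω : Type*} [MeasurableSpace Ω]
    {P : Measure Ω} [IsProbabilityMeasure P] {W : Ω → ℝ} {c : ℝ≥0} (hc : c ≠ 0)
    (hW : HasSubgaussianMGF W c P) :
    ∫⁻ ω, ENNReal.ofReal (Real.exp (W ω ^ 2 / (4 * c))) ∂P ≤ ENNReal.ofReal √2 := by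
  have hc' : (0 : ℝ) < c := by positivity
  have hsq : √(2 * c : ℝ) ^ 2 = 2 * c := Real.sq_sqrt (by positivity)
  -- Linearisation: the exponential of a square is a Gaussian average of exponentials of linear
  -- terms. After Tonelli, the sub-Gaussian bound at `g / √(2c)` leaves `exp(g² / 4)`.
  have hg : ∀ w : ℝ, ENNReal.ofReal (Real.exp (w ^ 2 / (4 * c))) =
      ∫⁻ g, ENNReal.ofReal (Real.exp (w / √(2 * c) * g)) ∂(gaussianReal 0 1) := by
    intro w
    rw [← ofReal_integral_eq_lintegral_ofReal]
    · have h := congrFun (mgf_id_gaussianReal (μ := 0) (v := 1)) (w / √(2 * c))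
      simp only [mgf, id] at h
      rw [h, div_pow, hsq]
      congr 2
      simp
      field_simp
      norm_num
    · simpa using integrable_exp_mul_gaussianReal (μ := 0) (v := 1) (w / √(2 * c))
    · exact .of_forall fun x => by positivity
  have hWm := hW.aemeasurable
  calc ∫⁻ ω, ENNReal.ofReal (Real.exp (W ω ^ 2 / (4 * c))) ∂P
      = ∫⁻ ω, ∫⁻ g, ENNReal.ofReal (Real.exp (W ω / √(2 * c) * g)) ∂(gaussianReal 0 1) ∂P := by
        exact lintegral_congr fun ω => hg _
    _ = ∫⁻ g, ∫⁻ ω, ENNReal.ofReal (Real.exp (W ω / √(2 * c) * g)) ∂P ∂(gaussianReal 0 1) := by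
        apply lintegral_lintegral_swap
        have h1 : AEMeasurable (fun p : Ω × ℝ => W p.1) (P.prod (gaussianReal 0 1)) :=
          hWm.comp_fst
        have h2 : AEMeasurable (fun p : Ω × ℝ => p.2) (P.prod (gaussianReal 0 1)) :=
          measurable_snd.aemeasurable
        exact (((h1.div_const _).mul h2).exp).ennreal_ofReal
    _ ≤ ∫⁻ g, ENNReal.ofReal (Real.exp (g ^ 2 / 4)) ∂(gaussianReal 0 1) := by
        refine lintegral_mono fun g => ?_
        have e : ∀ ω, W ω / √(2 * c) * g = (g / √(2 * c)) * W ω := fun ω => by ring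
        simp only [e]
        rw [← ofReal_integral_eq_lintegral_ofReal (hW.integrable_exp_mul _)
          (.of_forall fun x => by positivity)]
        apply ENNReal.ofReal_le_ofReal
        refine (hW.mgf_le _).trans (Real.exp_le_exp.2 (le_of_eq ?_))
        rw [div_pow, hsq]
        field_simp
        norm_num
    _ ≤ _ := lintegral_exp_sq_div_four_gaussianReal_le

/-- Taylor remainder of order two. Keeping the linear term exact lets it vanish in expectation for a
centred variable, leaving a bound quadratic in the parameter. -/
lemma Real.exp_le_one_add_add_sq_mul_exp_abs (x : ℝ) :
    Real.exp x ≤ 1 + x + x ^ 2 * Real.exp |x| := by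
  have h := Complex.norm_exp_sub_sum_le_norm_mul_exp (x : ℂ) 2
  have h2 : ‖Complex.exp x - ∑ m ∈ Finset.range 2, (x : ℂ) ^ m / m.factorial‖ =
      |Real.exp x - (1 + x)| := by
    rw [← Real.norm_eq_abs, ← Complex.norm_real]
    simp [Finset.sum_range_succ]
  rw [h2, Complex.norm_real, Real.norm_eq_abs, sq_abs] at h
  linarith [le_abs_self (Real.exp x - (1 + x))]

/-- The centred square of a sub-Gaussian variable of unit second moment is sub-exponential. -/
lemma ProbabilityTheory.HasSubgaussianMGF.lintegral_exp_mul_sq_sub_one_le {Ω : Type*}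
    [MeasurableSpace Ω] {P : Measure Ω} [IsProbabilityMeasure P] {W : Ω → ℝ}
    (hW : HasSubgaussianMGF W 3 P) (hvar : ∫ ω, W ω ^ 2 ∂P = 1) {θ : ℝ} (hθ : |θ| ≤ 1 / 24) :
    ∫⁻ ω, ENNReal.ofReal (Real.exp (θ * (W ω ^ 2 - 1))) ∂P ≤
      ENNReal.ofReal (Real.exp (2304 * θ ^ 2)) := by
  have hWm := hW.aemeasurable
  have hE : ∫⁻ ω, ENNReal.ofReal (Real.exp (W ω ^ 2 / 12)) ∂P ≤ ENNReal.ofReal √2 := by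
    have h := hW.lintegral_exp_sq_le (by norm_num)
    norm_num at h
    exact h
  have hint2 : Integrable (fun ω => W ω ^ 2) P := (hW.memLp 2).integrable_sq
  have hintE : Integrable (fun ω => Real.exp (W ω ^ 2 / 12)) P := by
    refine ⟨by fun_prop, ?_⟩
    rw [hasFiniteIntegral_iff_ofReal (.of_forall fun x => by positivity)]
    exact hE.trans_lt ENNReal.ofReal_lt_top
  have hEle : ∫ ω, Real.exp (W ω ^ 2 / 12) ∂P ≤ √2 := by
    rw [integral_eq_lintegral_of_nonneg_ae (.of_forall fun x => by positivity) hintE.1]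
    exact ENNReal.toReal_le_of_le_ofReal (by positivity) hE
  have hpt : ∀ w : ℝ, Real.exp (θ * (w ^ 2 - 1)) ≤
      1 + θ * (w ^ 2 - 1) + θ ^ 2 * (1152 * Real.exp (1 / 12)) * Real.exp (w ^ 2 / 12) := by
    intro w
    refine (Real.exp_le_one_add_add_sq_mul_exp_abs _).trans ?_
    set V := w ^ 2 - 1
    have hVabs : |V| ≤ w ^ 2 + 1 := by
      rw [abs_le]; constructor <;> simp only [V] <;> nlinarith [sq_nonneg w]
    -- From `x² / 2 ≤ exp x` at `x = |V| / 24`, so `1152 = 2 * 24²`. With `|θ| ≤ 1 / 24` the two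
    -- exponentials combine to `exp(|V| / 12)`, the moment controlled by `hE`.
    have h1 : V ^ 2 ≤ 1152 * Real.exp (|V| / 24) := by
      have := Real.pow_div_factorial_le_exp (|V| / 24) (by positivity) 2
      rw [div_pow, sq_abs] at this
      norm_num at this
      linarith
    have h2 : |θ * V| ≤ |V| / 24 := by
      rw [abs_mul]; nlinarith [abs_nonneg V]
    have h3 : V ^ 2 * Real.exp |θ * V| ≤
        1152 * Real.exp (1 / 12) * Real.exp (w ^ 2 / 12) := by
      calc V ^ 2 * Real.exp |θ * V| ≤ (1152 * Real.exp (|V| / 24)) * Real.exp (|V| / 24) := by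
            gcongr
        _ = 1152 * Real.exp (|V| / 12) := by
            rw [mul_assoc, ← Real.exp_add]; congr 2; ring
        _ ≤ 1152 * Real.exp (1 / 12 + w ^ 2 / 12) := by
            gcongr; linarith
        _ = _ := by rw [Real.exp_add]; ring
    rw [mul_pow]
    nlinarith [mul_le_mul_of_nonneg_left h3 (sq_nonneg θ)]
  have hi0 : Integrable (fun ω => θ * (W ω ^ 2 - 1)) P :=
    (hint2.sub (integrable_const _)).const_mul _
  have hi1 : Integrable (fun ω => 1 + θ * (W ω ^ 2 - 1)) P := (integrable_const _).add hi0
  have hi2 : Integrable (fun ω => θ ^ 2 * (1152 * Real.exp (1 / 12)) * Real.exp (W ω ^ 2 / 12)) P :=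
    hintE.const_mul _
  calc ∫⁻ ω, ENNReal.ofReal (Real.exp (θ * (W ω ^ 2 - 1))) ∂P
      ≤ ∫⁻ ω, ENNReal.ofReal (1 + θ * (W ω ^ 2 - 1) +
          θ ^ 2 * (1152 * Real.exp (1 / 12)) * Real.exp (W ω ^ 2 / 12)) ∂P :=
        lintegral_mono fun ω => ENNReal.ofReal_le_ofReal (hpt _)
    _ = ENNReal.ofReal (∫ ω, (1 + θ * (W ω ^ 2 - 1) +
          θ ^ 2 * (1152 * Real.exp (1 / 12)) * Real.exp (W ω ^ 2 / 12)) ∂P) := by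
        refine (ofReal_integral_eq_lintegral_ofReal (hi1.add hi2) ?_).symm
        exact .of_forall fun ω => (Real.exp_pos _).le.trans (hpt _)
    _ ≤ _ := by
        apply ENNReal.ofReal_le_ofReal
        rw [integral_add hi1 hi2, integral_add (integrable_const _) hi0,
          integral_const_mul, integral_const_mul,
          integral_sub hint2 (integrable_const _), hvar]
        simp only [integral_const, probReal_univ, smul_eq_mul, mul_one, sub_self, mul_zero,
          add_zero]
        have hs : √2 ≤ 1.5 := by
          rw [Real.sqrt_le_left (by norm_num)]; norm_num
        have he : Real.exp (1 / 12) ≤ 4 / 3 := by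
          have := Real.exp_bound_div_one_sub_of_interval (x := 1 / 12) (by norm_num) (by norm_num)
          norm_num at this ⊢
          linarith
        have h0 : 0 ≤ ∫ ω, Real.exp (W ω ^ 2 / 12) ∂P := integral_nonneg fun _ => by positivity
        -- The product is at most `2`, which turns `1152` into `2304`.
        have : Real.exp (1 / 12) * ∫ ω, Real.exp (W ω ^ 2 / 12) ∂P ≤ 4 / 3 * 1.5 := by
          gcongr; exact hEle.trans hs
        refine le_trans ?_ (Real.add_one_le_exp _)
        nlinarith [mul_le_mul_of_nonneg_left this (sq_nonneg θ)]

lemma ProbabilityTheory.HasSubgaussianMGF.mono_param {Ω : Type*} [MeasurableSpace Ω]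
    {P : Measure Ω} {X : Ω → ℝ} {c c' : ℝ≥0} (h : HasSubgaussianMGF X c P) (hc : c ≤ c') :
    HasSubgaussianMGF X c' P where
  integrable_exp_mul := h.integrable_exp_mul
  mgf_le t := (h.mgf_le t).trans <| Real.exp_le_exp.2 <| by
    have : (c : ℝ) ≤ c' := by exact_mod_cast hc
    gcongr

/-! ### Moments of the three entry laws -/

namespace EntryDist

instance (D : EntryDist) (n : ℕ) : IsProbabilityMeasure (D.law n) := by
  cases D
  · simp only [law]; infer_instance
  · constructor
    simp [law, ENNReal.inv_two_add_inv_two]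
  · constructor
    simp only [law, Measure.coe_add, Measure.coe_smul, Pi.add_apply, Pi.smul_apply, measure_univ,
      smul_eq_mul, mul_one]
    rw [← ENNReal.toReal_eq_one_iff, ENNReal.toReal_add (by finiteness) (by finiteness),
      ENNReal.toReal_add (by finiteness) (by finiteness)]
    norm_num

lemma integral_law_bernoulli (n : ℕ) (f : ℝ → ℝ) :
    ∫ x, f x ∂(law .bernoulli n) = (f (1 / √n) + f (-(1 / √n))) / 2 := by
  simp only [law]
  have h : ∀ a : ℝ, Integrable f ((1 / 2 : ℝ≥0∞) • Measure.dirac a) := fun a =>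
    Integrable.smul_measure (integrable_dirac (by finiteness)) (by finiteness)
  rw [integral_add_measure (h _) (h _)]
  simp
  ring

lemma integral_law_ternary (n : ℕ) (f : ℝ → ℝ) :
    ∫ x, f x ∂(law .ternary n) = (f √(3 / n) + 4 * f 0 + f (-√(3 / n))) / 6 := by
  simp only [law]
  have h : ∀ a : ℝ, ∀ c : ℝ≥0∞, c ≠ ⊤ → Integrable f (c • Measure.dirac a) := fun a c hc =>
    Integrable.smul_measure (integrable_dirac (by finiteness)) hc
  rw [integral_add_measure ((h _ _ (by finiteness)).add_measure (h _ _ (by finiteness)))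
    (h _ _ (by finiteness)), integral_add_measure (h _ _ (by finiteness)) (h _ _ (by finiteness))]
  simp
  ring

lemma integral_law (D : EntryDist) (n : ℕ) : ∫ x, x ∂(D.law n) = 0 := by
  cases D
  · simp [law, integral_id_gaussianReal]
  · rw [integral_law_bernoulli]; ring
  · rw [integral_law_ternary]; ring

lemma variance_law (D : EntryDist) {n : ℕ} (hn : n ≠ 0) : Var[id; D.law n] = 1 / n := by
  have hn' : (0 : ℝ) < n := by positivity
  cases D
  · simp [law, variance_id_gaussianReal]
  · rw [variance_of_integral_eq_zero aemeasurable_id (integral_law _ _)]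
    simp only [id, integral_law_bernoulli, neg_sq, div_pow, Real.sq_sqrt hn'.le]
    ring
  · rw [variance_of_integral_eq_zero aemeasurable_id (integral_law _ _)]
    have : (0 : ℝ) ≤ 3 / n := by positivity
    simp only [id, integral_law_ternary, neg_sq, Real.sq_sqrt this]
    ring

/-- Both discrete laws are centred and live in `[-√(3/n), √(3/n)]`, so Hoeffding's lemma gives `3 /
n`. The Gaussian parameter `1 / n` is smaller. -/
lemma hasSubgaussianMGF_law (D : EntryDist) {n : ℕ} (hn : n ≠ 0) :
    HasSubgaussianMGF id (3 / n) (D.law n) := by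
  have hn' : (0 : ℝ) < n := by positivity
  have key : ∀ D : EntryDist, (∀ᵐ x ∂(D.law n), x ∈ Set.Icc (-√(3 / n : ℝ)) √(3 / n)) →
      HasSubgaussianMGF id (3 / n) (D.law n) := by
    intro D h
    refine (hasSubgaussianMGF_of_mem_Icc_of_integral_eq_zero aemeasurable_id h
      (integral_law _ _)).mono_param (le_of_eq ?_)
    rw [← NNReal.coe_inj]
    push_cast
    rw [Real.norm_of_nonneg (by simp; positivity), sub_neg_eq_add, add_self_div_two,
      Real.sq_sqrt (by positivity)]
  cases D
  · refine ⟨fun t => integrable_exp_mul_gaussianReal t, fun t => ?_⟩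
    rw [law, mgf_id_gaussianReal]
    apply Real.exp_le_exp.2
    push_cast
    rw [zero_mul, zero_add]
    gcongr
    norm_num
  · apply key
    have : 1 / √(n : ℝ) ≤ √(3 / n) := by
      rw [← Real.sqrt_one, ← Real.sqrt_div zero_le_one]
      apply Real.sqrt_le_sqrt
      gcongr
      norm_num
    have h0 : 0 ≤ 1 / √(n : ℝ) := by positivity
    simp only [law, ae_add_measure_iff]
    constructor <;> refine Measure.ae_smul_measure ?_ _ <;>
      refine (ae_dirac_iff measurableSet_Icc).2 ⟨?_, ?_⟩ <;> linarith
  · apply key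
    have h0 : 0 ≤ √(3 / n : ℝ) := by positivity
    simp only [law, ae_add_measure_iff]
    refine ⟨⟨?_, ?_⟩, ?_⟩ <;> refine Measure.ae_smul_measure ?_ _ <;>
      refine (ae_dirac_iff measurableSet_Icc).2 ⟨?_, ?_⟩ <;> linarith

end EntryDist

/-! ### Normalised linear forms in the entries -/

section LinearCombination

variable {Ω Q κ : Type*} [MeasurableSpace Ω] {P : Measure Ω}
  {D : EntryDist} {n : ℕ} {X : Q → Ω → ℝ}

/-- Sub-Gaussian parameters add over independent terms. The normalisation `∑ a² = n` cancels the `1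
/ n` of the entries, so the parameter does not depend on the dimensions. -/
lemma hasSubgaussianMGF_sum_mul_of_hasLaw (hn : n ≠ 0) (hX : ∀ q, HasLaw (X q) (D.law n) P)
    (hind : iIndepFun X P) {T : Finset κ} {i : κ → Q} (hi : Function.Injective i) {a : κ → ℝ}
    (ha : ∑ t ∈ T, a t ^ 2 = n) :
    HasSubgaussianMGF (fun ω => ∑ t ∈ T, a t * X (i t) ω) 3 P := by
  have hsub : ∀ q, HasSubgaussianMGF (X q) (3 / n) P := fun q => by
    have h := D.hasSubgaussianMGF_law hn
    rw [← (hX q).map_eq] at h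
    exact (HasSubgaussianMGF.id_map_iff (hX q).aemeasurable).1 h
  have hind' : iIndepFun (fun t ω => a t * X (i t) ω) P :=
    (hind.precomp hi).comp (fun t x => a t * x) fun t => by fun_prop
  have hmul : ∀ t, HasSubgaussianMGF (fun ω => a t * X (i t) ω)
      ((a t ^ 2).toNNReal * (3 / n)) P := fun t =>
    ((hsub (i t)).const_mul (a t)).mono_param <| by
      rw [Real.toNNReal_of_nonneg (sq_nonneg _)]
      exact le_rfl
  refine (HasSubgaussianMGF.sum_of_iIndepFun hind' (s := T)
    fun t _ => hmul t).mono_param (le_of_eq ?_)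
  have hn' : (n : ℝ) ≠ 0 := by positivity
  rw [← NNReal.coe_inj, ← Finset.sum_mul]
  push_cast
  simp only [Real.coe_toNNReal _ (sq_nonneg _)]
  rw [ha]
  field_simp

lemma integral_sq_sum_mul_of_hasLaw [IsProbabilityMeasure P] (hn : n ≠ 0)
    (hX : ∀ q, HasLaw (X q) (D.law n) P) (hind : iIndepFun X P) {T : Finset κ} {i : κ → Q}
    (hi : Function.Injective i) {a : κ → ℝ} (ha : ∑ t ∈ T, a t ^ 2 = n) :
    ∫ ω, (∑ t ∈ T, a t * X (i t) ω) ^ 2 ∂P = 1 := by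
  have hmem : ∀ q, MemLp (X q) 2 P := fun q => by
    have h := D.hasSubgaussianMGF_law hn
    rw [← (hX q).map_eq] at h
    exact ((HasSubgaussianMGF.id_map_iff (hX q).aemeasurable).1 h).memLp 2
  have hW := hasSubgaussianMGF_sum_mul_of_hasLaw hn hX hind hi ha
  have hind' : iIndepFun (fun t ω => a t * X (i t) ω) P :=
    (hind.precomp hi).comp (fun t x => a t * x) fun t => by fun_prop
  have h0 : ∫ ω, ∑ t ∈ T, a t * X (i t) ω ∂P = 0 := by
    rw [integral_finsetSum _ fun t _ => ((hmem (i t)).integrable (by norm_num)).const_mul _]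
    refine Finset.sum_eq_zero fun t _ => ?_
    rw [integral_const_mul, (hX (i t)).integral_eq, D.integral_law, mul_zero]
  rw [← variance_of_integral_eq_zero hW.aemeasurable h0]
  have h := IndepFun.variance_sum (μ := P) (s := T) (X := fun t ω => a t * X (i t) ω)
    (fun t _ => (hmem (i t)).const_mul _) fun t _ t' _ htt => hind'.indepFun htt
  have e : (fun ω => ∑ t ∈ T, a t * X (i t) ω) = ∑ t ∈ T, fun ω => a t * X (i t) ω := by
    ext ω; simp
  rw [e, h]
  have hn' : (n : ℝ) ≠ 0 := by positivity
  simp only [variance_const_mul, (hX _).variance_eq, D.variance_law hn]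
  rw [← Finset.sum_mul, ha]
  field_simp

end LinearCombination

/-! ### Deviation bounds for partially dependent sums -/

section Tail

variable {Ω Q R : Type*} [MeasurableSpace Ω] {P : Measure Ω}

/-- Functions of pairwise disjoint groups of independent variables are independent, in the form of
a product formula for integrals. -/
lemma lintegral_prod_eq_prod_lintegral_of_dependsOn {X : Q → Ω → ℝ} (hind : iIndepFun X P)
    (hX : ∀ q, AEMeasurable (X q) P) [Finite Q] (S : R → Finset Q) (G : R → (Q → ℝ) → ℝ≥0∞)
    (hG : ∀ r, Measurable (G r)) (hdep : ∀ r, DependsOn (G r) (S r)) (A : Finset R)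
    (hA : (A : Set R).PairwiseDisjoint S) :
    ∫⁻ ω, ∏ r ∈ A, G r (fun q => X q ω) ∂P = ∏ r ∈ A, ∫⁻ ω, G r (fun q => X q ω) ∂P := by
  classical
  have := hind.isProbabilityMeasure
  induction A using Finset.induction_on with
  | empty => simp
  | insert r A hr ih =>
    have hXX : AEMeasurable (fun ω q => X q ω) P := aemeasurable_pi_lambda _ hX
    simp only [Finset.prod_insert hr]
    rw [← ih (hA.subset (by simp))]
    set U := A.biUnion S with hU
    have hdisj : Disjoint (S r) U := by
      rw [hU, Finset.disjoint_biUnion_right]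
      intro r' hr'
      exact hA (by simp) (by simp [hr']) (fun h => hr (h ▸ hr'))
    -- Zero-extension makes `G r` a function of the variables in `V` alone; by `hdep` the filled-in
    -- values do not matter.
    let ext (V : Finset Q) (y : V → ℝ) : Q → ℝ := fun q => if h : q ∈ V then y ⟨q, h⟩ else 0
    have hext : ∀ V, Measurable (ext V) := fun V => by
      refine measurable_pi_lambda _ fun q => ?_
      by_cases h : q ∈ V
      · simp only [ext, h, dite_true]; fun_prop
      · simp only [ext, h, dite_false]; fun_prop
    have h1 := (hind.indepFun_finset₀ (S r) U hdisj hX).comp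
      (φ := fun y => G r (ext (S r) y)) (ψ := fun y => ∏ r' ∈ A, G r' (ext U y))
      ((hG r).comp (hext _))
      (Finset.measurable_fun_prod _ fun r' _ => (hG r').comp (hext _))
    have e1 : ((fun y => G r (ext (S r) y)) ∘ fun ω (i : S r) => X i ω) =
        fun ω => G r (fun q => X q ω) := by
      ext ω
      exact hdep r fun q hq => by simp [ext, Finset.mem_coe.1 hq]
    have e2 : ((fun y => ∏ r' ∈ A, G r' (ext U y)) ∘ fun ω (i : U) => X i ω) =
        fun ω => ∏ r' ∈ A, G r' (fun q => X q ω) := by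
      ext ω
      refine Finset.prod_congr rfl fun r' hr' => hdep r' fun q hq => ?_
      have : q ∈ U := Finset.mem_biUnion.2 ⟨r', hr', hq⟩
      simp [ext, this]
    rw [e1, e2] at h1
    exact lintegral_mul_eq_lintegral_mul_lintegral_of_indepFun''
      ((hG r).comp_aemeasurable hXX)
      (Finset.aemeasurable_fun_prod _ fun r' _ => (hG r').comp_aemeasurable hXX) h1

/-- Hölder's inequality along a colouring: if variables of equal colour multiply in expectation,
exponential moments of the total sum are controlled with a loss of the number of colours. -/
lemma lintegral_exp_sum_le_of_coloring [Fintype R] {q : ℕ} (hq : q ≠ 0) (C : R → Fin q)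
    {V : R → Ω → ℝ} (hV : ∀ r, AEMeasurable (V r) P)
    (hprod : ∀ (g : Fin q) (θ : ℝ),
      ∫⁻ ω, ∏ r with C r = g, ENNReal.ofReal (Real.exp (θ * V r ω)) ∂P =
        ∏ r with C r = g, ∫⁻ ω, ENNReal.ofReal (Real.exp (θ * V r ω)) ∂P)
    {b K : ℝ} (hmgf : ∀ r, ∀ θ : ℝ, |θ| ≤ b →
      ∫⁻ ω, ENNReal.ofReal (Real.exp (θ * V r ω)) ∂P ≤ ENNReal.ofReal (Real.exp (K * θ ^ 2)))
    {l : ℝ} (hl : |l * q| ≤ b) :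
    ∫⁻ ω, ENNReal.ofReal (Real.exp (l * ∑ r, V r ω)) ∂P ≤
      ENNReal.ofReal (Real.exp (K * l ^ 2 * q * Fintype.card R)) := by
  classical
  have hq' : (0 : ℝ) < q := by positivity
  have hpt : ∀ ω, ENNReal.ofReal (Real.exp (l * ∑ r, V r ω)) =
      ∏ g : Fin q, (∏ r with C r = g, ENNReal.ofReal (Real.exp (l * q * V r ω))) ^ (1 / q : ℝ) := by
    intro ω
    have h1 : ∀ r, ENNReal.ofReal (Real.exp (l * q * V r ω)) ^ (1 / q : ℝ) =
        ENNReal.ofReal (Real.exp (l * V r ω)) := by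
      intro r
      rw [ENNReal.ofReal_rpow_of_pos (Real.exp_pos _), ← Real.exp_mul]
      congr 2
      field_simp
    have h2 : ∀ g, (∏ r with C r = g, ENNReal.ofReal (Real.exp (l * q * V r ω))) ^ (1 / q : ℝ) =
        ∏ r with C r = g, ENNReal.ofReal (Real.exp (l * V r ω)) := by
      intro g
      rw [← ENNReal.prod_rpow_of_nonneg (by positivity)]
      exact Finset.prod_congr rfl fun r _ => h1 r
    simp only [h2]
    rw [Finset.prod_fiberwise, ← ENNReal.ofReal_prod_of_nonneg (fun _ _ => by positivity),
      ← Real.exp_sum, Finset.mul_sum]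
  calc ∫⁻ ω, ENNReal.ofReal (Real.exp (l * ∑ r, V r ω)) ∂P
      = ∫⁻ ω, ∏ g : Fin q,
          (∏ r with C r = g, ENNReal.ofReal (Real.exp (l * q * V r ω))) ^ (1 / q : ℝ) ∂P :=
        lintegral_congr hpt
    _ ≤ ∏ g : Fin q,
          (∫⁻ ω, ∏ r with C r = g, ENNReal.ofReal (Real.exp (l * q * V r ω)) ∂P) ^ (1 / q : ℝ) := by
        apply ENNReal.lintegral_prod_norm_pow_le
        · intro g _
          exact Finset.aemeasurable_fun_prod _ fun r _ =>
            (((hV r).const_mul _).exp).ennreal_ofReal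
        · simp [hq]
        · intros; positivity
    _ ≤ ∏ g : Fin q,
          (∏ r with C r = g, ENNReal.ofReal (Real.exp (K * (l * q) ^ 2))) ^ (1 / q : ℝ) := by
        gcongr with g _
        rw [hprod]
        exact Finset.prod_le_prod' fun r _ => hmgf r _ hl
    _ = ENNReal.ofReal (Real.exp (K * l ^ 2 * q * Fintype.card R)) := by
        have : ∀ g, (∏ r with C r = g, ENNReal.ofReal (Real.exp (K * (l * q) ^ 2))) ^ (1 / q : ℝ) =
            ∏ r with C r = g, ENNReal.ofReal (Real.exp (K * l ^ 2 * q)) := by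
          intro g
          rw [← ENNReal.prod_rpow_of_nonneg (by positivity)]
          refine Finset.prod_congr rfl fun r _ => ?_
          rw [ENNReal.ofReal_rpow_of_pos (Real.exp_pos _), ← Real.exp_mul]
          congr 2
          field_simp
        simp only [this]
        rw [Finset.prod_fiberwise, ← ENNReal.ofReal_prod_of_nonneg (fun _ _ => by positivity),
          ← Real.exp_sum]
        simp
        ring_nf

/-- Two-sided Bernstein-type deviation bound along a colouring. -/
lemma measure_abs_sum_ge_le_of_coloring [Fintype R] {q : ℕ} (hq : q ≠ 0) (C : R → Fin q)
    {V : R → Ω → ℝ} (hV : ∀ r, AEMeasurable (V r) P)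
    (hprod : ∀ (g : Fin q) (θ : ℝ),
      ∫⁻ ω, ∏ r with C r = g, ENNReal.ofReal (Real.exp (θ * V r ω)) ∂P =
        ∏ r with C r = g, ∫⁻ ω, ENNReal.ofReal (Real.exp (θ * V r ω)) ∂P)
    (hmgf : ∀ r, ∀ θ : ℝ, |θ| ≤ 1 / 24 →
      ∫⁻ ω, ENNReal.ofReal (Real.exp (θ * V r ω)) ∂P ≤ ENNReal.ofReal (Real.exp (2304 * θ ^ 2)))
    {η : ℝ} (hη : 0 < η) (hη1 : η ≤ 1) :
    P {ω | η * Fintype.card R ≤ |∑ r, V r ω|} ≤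
      2 * ENNReal.ofReal (Real.exp (-(η ^ 2 / 9216 * (Fintype.card R / q)))) := by
  have hq' : (0 : ℝ) < q := by positivity
  set c : ℝ := (Fintype.card R : ℝ)
  have hside : ∀ σ : ℝ, |σ| = 1 → P {ω | η * c ≤ σ * ∑ r, V r ω} ≤
      ENNReal.ofReal (Real.exp (-(η ^ 2 / 9216 * (c / q)))) := by
    intro σ hσ
    have hσ2 : σ ^ 2 = 1 := by rw [← sq_abs, hσ, one_pow]
    -- The parameter `η / (4608 q)` minimises `2304 l² q c - l η c`, with minimum `-η² c / (9216
    -- q)`.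
    have hl : |σ * (η / (4608 * q)) * q| ≤ 1 / 24 := by
      have : σ * (η / (4608 * q)) * q = σ * (η / 4608) := by field_simp
      rw [this, abs_mul, hσ, one_mul, abs_of_pos (by positivity)]
      linarith
    have hE := lintegral_exp_sum_le_of_coloring hq C hV hprod hmgf hl
    have hsub : {ω | η * c ≤ σ * ∑ r, V r ω} ⊆ {ω | ENNReal.ofReal
        (Real.exp (η / (4608 * q) * (η * c))) ≤
          ENNReal.ofReal (Real.exp (σ * (η / (4608 * q)) * ∑ r, V r ω))} := by
      intro ω hω
      apply ENNReal.ofReal_le_ofReal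
      apply Real.exp_le_exp.2
      have : σ * (η / (4608 * q)) * ∑ r, V r ω = η / (4608 * q) * (σ * ∑ r, V r ω) := by ring
      rw [this]
      exact mul_le_mul_of_nonneg_left hω (by positivity)
    have hM := mul_meas_ge_le_lintegral₀ (μ := P)
      (f := fun ω => ENNReal.ofReal (Real.exp (σ * (η / (4608 * q)) * ∑ r, V r ω)))
      ((((Finset.aemeasurable_fun_sum _ fun r _ => hV r).const_mul _).exp).ennreal_ofReal)
      (ENNReal.ofReal (Real.exp (η / (4608 * q) * (η * c))))
    have h1 := (mul_le_mul_right (measure_mono hsub) _).trans (hM.trans hE)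
    have hne : ENNReal.ofReal (Real.exp (η / (4608 * q) * (η * c))) ≠ 0 := by
      simp [Real.exp_pos]
    rw [mul_comm, ← ENNReal.le_div_iff_mul_le (.inl hne) (.inl ENNReal.ofReal_ne_top),
      ← ENNReal.ofReal_div_of_pos (Real.exp_pos _), ← Real.exp_sub] at h1
    refine h1.trans (ENNReal.ofReal_le_ofReal (Real.exp_le_exp.2 (le_of_eq ?_)))
    rw [mul_pow, hσ2]
    field_simp
    ring
  have hsub : {ω | η * c ≤ |∑ r, V r ω|} ⊆
      {ω | η * c ≤ 1 * ∑ r, V r ω} ∪ {ω | η * c ≤ (-1) * ∑ r, V r ω} := by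
    intro ω hω
    rcases abs_cases (∑ r, V r ω) with h | h
    · refine Or.inl (show η * c ≤ 1 * ∑ r, V r ω from ?_)
      linarith [h.1, show η * c ≤ |∑ r, V r ω| from hω]
    · refine Or.inr (show η * c ≤ -1 * ∑ r, V r ω from ?_)
      linarith [h.1, show η * c ≤ |∑ r, V r ω| from hω]
  refine (measure_mono hsub).trans ((measure_union_le _ _).trans ?_)
  rw [two_mul]
  exact add_le_add (hside 1 (by simp)) (hside (-1) (by simp))

end Tail

/-! ### Nets and quadratic forms -/

section Net

/-- A largest `1`-separated subset of the ball of radius `2` covers that ball, and volume comparison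
bounds its size. -/
lemma exists_finset_card_le_cover {E : Type*} [NormedAddCommGroup E] [NormedSpace ℝ E]
    [FiniteDimensional ℝ E] :
    ∃ S : Finset E, S.card ≤ 5 ^ Module.finrank ℝ E ∧
      ∀ x : E, ‖x‖ ≤ 2 → ∃ y ∈ S, ‖x - y‖ < 1 := by
  classical
  let p : ℕ → Prop := fun k => ∃ S : Finset E, S.card = k ∧ (∀ c ∈ S, ‖c‖ ≤ 2) ∧
    ∀ c ∈ S, ∀ d ∈ S, c ≠ d → 1 ≤ ‖c - d‖
  have hbound : ∀ k, p k → k ≤ 5 ^ Module.finrank ℝ E := by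
    rintro k ⟨S, rfl, h1, h2⟩
    exact Besicovitch.card_le_of_separated S h1 h2
  have h0 : p 0 := ⟨∅, by simp⟩
  obtain ⟨S, hcard, h1, h2⟩ := Nat.findGreatest_spec (P := p)
    (Nat.zero_le (5 ^ Module.finrank ℝ E)) h0
  refine ⟨S, hcard ▸ Nat.findGreatest_le _, fun x hx => ?_⟩
  by_contra! hcon
  have hxS : x ∉ S := fun h => by have := hcon x h; simp at this; linarith
  have hp : p (S.card + 1) := by
    refine ⟨insert x S, Finset.card_insert_of_notMem hxS, ?_, ?_⟩
    · simpa using ⟨hx, h1⟩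
    · intro c hc d hd hcd
      rw [Finset.mem_insert] at hc hd
      rcases hc with rfl | hc <;> rcases hd with rfl | hd
      · exact absurd rfl hcd
      · exact hcon d hd
      · rw [norm_sub_rev]; exact hcon c hc
      · exact h2 c hc d hd hcd
  have := Nat.le_findGreatest (hbound _ hp) hp
  omega

/-- The covering is applied twice: once to `2x`, then to twice the error. This gives accuracy `1 /
4` with `5² = 25` per dimension. -/
lemma exists_quarter_net (E : Type*) [NormedAddCommGroup E] [NormedSpace ℝ E]
    [FiniteDimensional ℝ E] :
    ∃ S : Finset E, S.card ≤ 25 ^ Module.finrank ℝ E ∧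
      ∀ x : E, ‖x‖ ≤ 1 → ∃ y ∈ S, ‖x - y‖ ≤ 1 / 4 := by
  classical
  obtain ⟨S, hS, hcov⟩ := exists_finset_card_le_cover (E := E)
  refine ⟨(S ×ˢ S).image fun p => (1 / 4 : ℝ) • ((2 : ℝ) • p.1 + p.2), ?_, fun x hx => ?_⟩
  · refine Finset.card_image_le.trans ?_
    rw [Finset.card_product]
    calc S.card * S.card ≤ 5 ^ Module.finrank ℝ E * 5 ^ Module.finrank ℝ E := Nat.mul_le_mul hS hS
      _ = _ := by rw [← mul_pow]; norm_num
  · obtain ⟨y₁, hy₁, h₁⟩ := hcov ((2 : ℝ) • x) (by rw [norm_smul]; norm_num; linarith)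
    obtain ⟨y₂, hy₂, h₂⟩ := hcov ((2 : ℝ) • ((2 : ℝ) • x - y₁))
      (by rw [norm_smul]; norm_num; linarith)
    refine ⟨_, Finset.mem_image.2 ⟨(y₁, y₂), Finset.mk_mem_product hy₁ hy₂, rfl⟩, ?_⟩
    have : x - (1 / 4 : ℝ) • ((2 : ℝ) • y₁ + y₂) =
        (1 / 4 : ℝ) • ((2 : ℝ) • ((2 : ℝ) • x - y₁) - y₂) := by module
    rw [this, norm_smul]
    norm_num
    linarith

/-- Near-isometry on a quarter net implies near-isometry on the whole space. -/
lemma abs_norm_sq_sub_le_of_net {E F : Type*} [NormedAddCommGroup E] [InnerProductSpace ℝ E]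
    [FiniteDimensional ℝ E] [NormedAddCommGroup F] [InnerProductSpace ℝ F] (A : E →ₗ[ℝ] F)
    {S : Finset E} (hS : ∀ x : E, ‖x‖ ≤ 1 → ∃ y ∈ S, ‖x - y‖ ≤ 1 / 4) {η : ℝ}
    (hη0 : 0 ≤ η) (hη : ∀ y ∈ S, |‖A y‖ ^ 2 - ‖y‖ ^ 2| ≤ η * ‖y‖ ^ 2) (x : E) :
    |‖A x‖ ^ 2 - ‖x‖ ^ 2| ≤ 4 * η * ‖x‖ ^ 2 := by
  set f : E → ℝ := fun x => ‖A x‖ ^ 2 - ‖x‖ ^ 2 with hf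
  have hcont : Continuous f := by
    have := A.continuous_of_finiteDimensional
    fun_prop
  obtain ⟨x₀, hx₀, hmax⟩ := (isCompact_closedBall (0 : E) 1).exists_isMaxOn
    ⟨0, by simp⟩ hcont.abs.continuousOn
  set M := |f x₀|
  have hsmul : ∀ (c : ℝ) x, f (c • x) = c ^ 2 * f x := by
    intro c x
    simp only [hf, map_smul, norm_smul, mul_pow, Real.norm_eq_abs, sq_abs]
    ring
  have hM : ∀ w, |f w| ≤ M * ‖w‖ ^ 2 := by
    intro w
    rcases eq_or_ne w 0 with rfl | hw
    · simp [hf]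
    have hw' : 0 < ‖w‖ := norm_pos_iff.2 hw
    have h := hmax (a := ‖w‖⁻¹ • w) (by simp [norm_smul, hw'.ne'])
    simp only [Set.mem_ofPred_eq, hsmul, abs_mul] at h
    rw [abs_of_nonneg (by positivity), inv_pow, inv_mul_le_iff₀ (by positivity)] at h
    rw [mul_comm]
    exact h
  obtain ⟨y, hy, hxy⟩ := hS x₀ (by simpa using hx₀)
  have hx₀' : ‖x₀‖ ≤ 1 := by simpa using hx₀
  have hyn : ‖y‖ ≤ 5 / 4 := by
    have := norm_sub_norm_le y x₀
    rw [norm_sub_rev] at this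
    linarith
  have hun : ‖x₀ + y‖ ≤ 9 / 4 := (norm_add_le _ _).trans (by linarith)
  -- Polarisation of the quadratic form `f` at the pair `x₀ + y`, `x₀ - y`. The scalings `1 / 3` and
  -- `3` balance their norm bounds `9 / 4` and `1 / 4`.
  have hpol : 4 * (f x₀ - f y) =
      f ((1 / 3 : ℝ) • (x₀ + y) + (3 : ℝ) • (x₀ - y)) -
        f ((1 / 3 : ℝ) • (x₀ + y) - (3 : ℝ) • (x₀ - y)) := by
    simp only [hf, map_add, map_sub, map_smul, norm_add_sq_real, norm_sub_sq_real, inner_add_left,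
      inner_sub_right, inner_smul_left, inner_smul_right,
      real_inner_self_eq_norm_sq, real_inner_comm y x₀, real_inner_comm (A y) (A x₀)]
    simp
    ring
  have h1 := hM ((1 / 3 : ℝ) • (x₀ + y) + (3 : ℝ) • (x₀ - y))
  have h2 := hM ((1 / 3 : ℝ) • (x₀ + y) - (3 : ℝ) • (x₀ - y))
  have hpar : ‖(1 / 3 : ℝ) • (x₀ + y) + (3 : ℝ) • (x₀ - y)‖ ^ 2 +
      ‖(1 / 3 : ℝ) • (x₀ + y) - (3 : ℝ) • (x₀ - y)‖ ^ 2 =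
      2 * (1 / 9 * ‖x₀ + y‖ ^ 2 + 9 * ‖x₀ - y‖ ^ 2) := by
    rw [norm_add_sq_real, norm_sub_sq_real, norm_smul, norm_smul]
    norm_num
    ring
  have hsum : ‖(1 / 3 : ℝ) • (x₀ + y) + (3 : ℝ) • (x₀ - y)‖ ^ 2 +
      ‖(1 / 3 : ℝ) • (x₀ + y) - (3 : ℝ) • (x₀ - y)‖ ^ 2 ≤ 9 / 4 := by
    rw [hpar]
    have a1 : ‖x₀ + y‖ ^ 2 ≤ (9 / 4) ^ 2 := by gcongr
    have a2 : ‖x₀ - y‖ ^ 2 ≤ (1 / 4) ^ 2 := by gcongr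
    linarith
  have hM0 : 0 ≤ M := abs_nonneg _
  have hdiff : |f x₀ - f y| ≤ 9 / 16 * M := by
    have h3 : |4 * (f x₀ - f y)| ≤ M * (9 / 4) := by
      rw [hpol]
      refine (abs_sub _ _).trans ?_
      nlinarith
    rw [abs_mul, abs_of_pos (by norm_num : (0 : ℝ) < 4)] at h3
    linarith
  have hfy : |f y| ≤ η * ‖y‖ ^ 2 := hη y hy
  -- From `M ≤ (9/16) M + (25/16) η`, that is `M ≤ (25/7) η`.
  have hMle : M ≤ 4 * η := by
    have h4 : M ≤ |f x₀ - f y| + |f y| := by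
      simpa using abs_add_le (f x₀ - f y) (f y)
    have : ‖y‖ ^ 2 ≤ (5 / 4) ^ 2 := by gcongr
    nlinarith
  exact (hM x).trans (by gcongr)

end Net

/-! ### Colourings of the rows -/

/-- Greedy colouring of a finite symmetric relation of degree at most `k`. -/
lemma exists_coloring_of_degree_le {V : Type*} [Fintype V] {adj : V → V → Prop} {k : ℕ}
    (hsymm : ∀ v w, adj v w → adj w v) (hirr : ∀ v, ¬ adj v v)
    (hdeg : ∀ v, {w | adj v w}.ncard ≤ k) :
    ∃ C : V → Fin (k + 1), ∀ v w, adj v w → C v ≠ C w := by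
  classical
  suffices h : ∀ A : Finset V, ∃ C : V → Fin (k + 1), ∀ v ∈ A, ∀ w ∈ A, adj v w → C v ≠ C w by
    obtain ⟨C, hC⟩ := h Finset.univ
    exact ⟨C, fun v w => hC v (by simp) w (by simp)⟩
  intro A
  induction A using Finset.induction_on with
  | empty => exact ⟨fun _ => 0, by simp⟩
  | insert v A hv ih =>
    obtain ⟨C, hC⟩ := ih
    obtain ⟨c, hc⟩ : ∃ c, c ∉ (Finset.univ.filter (adj v)).image C := by
      by_contra! hall
      have h1 : Fintype.card (Fin (k + 1)) ≤ ((Finset.univ.filter (adj v)).image C).card := by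
        rw [Finset.eq_univ_of_forall hall, Finset.card_univ]
      have h2 := h1.trans Finset.card_image_le
      have h3 := hdeg v
      rw [← Finset.coe_filter_univ, Set.ncard_coe_finset] at h3
      simp only [Fintype.card_fin] at h2
      omega
    have hc' : ∀ w, adj v w → C w ≠ c := fun w hw h =>
      hc (Finset.mem_image.2 ⟨w, by simpa using hw, h⟩)
    refine ⟨Function.update C v c, fun x hx y hy hxy => ?_⟩
    rcases eq_or_ne x v with rfl | hxv <;> rcases eq_or_ne y x with rfl | hyx
    · exact absurd hxy (hirr _)
    · simpa [hyx] using (hc' y hxy).symm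
    · exact absurd hxy (hirr _)
    · rcases eq_or_ne y v with rfl | hyv
      · simpa [hxv] using hc' x (hsymm _ _ hxy)
      · have hxA := (Finset.mem_insert.1 hx).resolve_left hxv
        have hyA := (Finset.mem_insert.1 hy).resolve_left hyv
        simpa [hxv, hyv] using hC x hxA y hyA hxy

/-- The position, among the independent variables, of the entry of a two-level circulant block
matrix in a given row and column. -/
def circulantIndex {l₁ l₂ d k₁ k₂ e : ℕ} (r : Fin l₁ × Fin l₂ × Fin d)
    (c : Fin k₁ × Fin k₂ × Fin e) : ZMod k₁ × ZMod k₂ × Fin d × Fin e :=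
  (((r.1 : ℕ) : ZMod k₁) - ((c.1 : ℕ) : ZMod k₁),
    ((r.2.1 : ℕ) : ZMod k₂) - ((c.2.1 : ℕ) : ZMod k₂), r.2.2, c.2.2)

lemma fin_eq_of_natCast_zmod_eq {l k : ℕ} (h : l ≤ k) {a b : Fin l}
    (hab : ((a : ℕ) : ZMod k) = ((b : ℕ) : ZMod k)) : a = b := by
  rw [ZMod.natCast_eq_natCast_iff', Nat.mod_eq_of_lt (a.2.trans_le h),
    Nat.mod_eq_of_lt (b.2.trans_le h)] at hab
  exact Fin.ext hab

lemma circulantIndex_injective {l₁ l₂ d k₁ k₂ e : ℕ} (r : Fin l₁ × Fin l₂ × Fin d) :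
    Function.Injective (circulantIndex (k₁ := k₁) (k₂ := k₂) (e := e) r) := by
  rintro ⟨u, v, j⟩ ⟨u', v', j'⟩ h
  simp only [circulantIndex, Prod.mk.injEq, sub_right_inj] at h
  rw [fin_eq_of_natCast_zmod_eq le_rfl h.1, fin_eq_of_natCast_zmod_eq le_rfl h.2.1, h.2.2.2]

lemma circulantIndex_row_eq {l₁ l₂ d k₁ k₂ e : ℕ} {r r' : Fin l₁ × Fin l₂ × Fin d}
    {c c' : Fin k₁ × Fin k₂ × Fin e} (h : circulantIndex r c = circulantIndex r' c')
    (h₁ : r.1 = r'.1) (h₂ : r.2.1 = r'.2.1) : r = r' := by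
  simp only [circulantIndex, Prod.mk.injEq] at h
  exact Prod.ext h₁ (Prod.ext h₂ h.2.2.1)

/-- Colouring the rows by their block index separates the rows sharing a variable. -/
lemma exists_row_coloring_by_block {l₁ l₂ d k₁ k₂ e : ℕ} (T : Finset (Fin k₁ × Fin k₂ × Fin e)) :
    ∃ C : Fin l₁ × Fin l₂ × Fin d → Fin (l₁ * l₂), ∀ r r', r ≠ r' → C r = C r' →
      ∀ t ∈ T, ∀ t' ∈ T, circulantIndex r t ≠ circulantIndex r' t' := by
  refine ⟨fun r => finProdFinEquiv (r.1, r.2.1), fun r r' hrr hC t _ t' _ h => hrr ?_⟩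
  have := finProdFinEquiv.injective hC
  rw [Prod.mk.injEq] at this
  exact circulantIndex_row_eq h this.1 this.2

/-- For a fixed set `T` of columns, a number of colours quadratic in `|T|` suffices to separate the
rows sharing a variable. -/
lemma exists_row_coloring_of_card_le {l₁ l₂ d k₁ k₂ e s : ℕ} (h₁ : l₁ ≤ k₁) (h₂ : l₂ ≤ k₂)
    (T : Finset (Fin k₁ × Fin k₂ × Fin e)) (hT : T.card ≤ s) :
    ∃ C : Fin l₁ × Fin l₂ × Fin d → Fin (s * (s - 1) + 1), ∀ r r', r ≠ r' → C r = C r' →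
      ∀ t ∈ T, ∀ t' ∈ T, circulantIndex r t ≠ circulantIndex r' t' := by
  classical
  let meets (p p' : Fin l₁ × Fin l₂) (x : (Fin k₁ × Fin k₂ × Fin e) × (Fin k₁ × Fin k₂ × Fin e)) :
      Prop :=
    ((p.1 : ℕ) : ZMod k₁) - ((x.1.1 : ℕ) : ZMod k₁) =
        ((p'.1 : ℕ) : ZMod k₁) - ((x.2.1 : ℕ) : ZMod k₁) ∧
      ((p.2 : ℕ) : ZMod k₂) - ((x.1.2.1 : ℕ) : ZMod k₂) =
        ((p'.2 : ℕ) : ZMod k₂) - ((x.2.2.1 : ℕ) : ZMod k₂)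
  let adj (p p' : Fin l₁ × Fin l₂) : Prop := p ≠ p' ∧ ∃ x ∈ T ×ˢ T, meets p p' x
  have hdeg : ∀ p, {p' | adj p p'}.ncard ≤ s * (s - 1) := by
    intro p
    -- A diagonal pair would force `p = p'`, because `l ≤ k` makes block rows distinct residues.
    -- Hence only ordered pairs of distinct columns count; such a pair together with `p` determines
    -- `p'`, so `F` is injective.
    have hx : ∀ p', adj p p' → ∃ x ∈ T.offDiag, meets p p' x := by
      rintro p' ⟨hne, x, hx, hm⟩
      refine ⟨x, ?_, hm⟩
      rw [Finset.mem_product] at hx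
      refine Finset.mem_offDiag.2 ⟨hx.1, hx.2, fun h => hne ?_⟩
      obtain ⟨hm₁, hm₂⟩ := hm
      rw [h, sub_left_inj] at hm₁ hm₂
      exact Prod.ext (fin_eq_of_natCast_zmod_eq h₁ hm₁) (fin_eq_of_natCast_zmod_eq h₂ hm₂)
    rcases {p' | adj p p'}.eq_empty_or_nonempty with hemp | ⟨p₀, hp₀⟩
    · simp [hemp]
    have : Nonempty ((Fin k₁ × Fin k₂ × Fin e) × (Fin k₁ × Fin k₂ × Fin e)) :=
      ⟨(hx p₀ hp₀).choose⟩
    choose! F hF hFm using hx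
    have hcard : {p' | adj p p'}.ncard ≤ (T.offDiag :
        Set ((Fin k₁ × Fin k₂ × Fin e) × (Fin k₁ × Fin k₂ × Fin e))).ncard := by
      refine Set.ncard_le_ncard_of_injOn F (fun p' hp' => hF p' hp') ?_ (Finset.finite_toSet _)
      intro p' hp' p'' hp'' hFF
      have e' := hFm p' hp'
      have e'' := hFm p'' hp''
      rw [← hFF] at e''
      have e₁ := e'.1.symm.trans e''.1
      have e₂ := e'.2.symm.trans e''.2
      rw [sub_left_inj] at e₁ e₂
      exact Prod.ext (fin_eq_of_natCast_zmod_eq h₁ e₁) (fin_eq_of_natCast_zmod_eq h₂ e₂)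
    rw [Set.ncard_coe_finset, Finset.offDiag_card] at hcard
    refine hcard.trans ?_
    rw [← Nat.mul_sub_one]
    exact Nat.mul_le_mul hT (Nat.sub_le_sub_right hT 1)
  have hsymm : ∀ p p', adj p p' → adj p' p := by
    rintro p p' ⟨hne, x, hx, hm⟩
    rw [Finset.mem_product] at hx
    exact ⟨hne.symm, x.swap, Finset.mem_product.2 ⟨hx.2, hx.1⟩, hm.1.symm, hm.2.symm⟩
  obtain ⟨C, hC⟩ := exists_coloring_of_degree_le hsymm (fun p h => h.1 rfl) hdeg
  refine ⟨fun r => C (r.1, r.2.1), fun r r' hrr hCC t ht t' ht' h => ?_⟩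
  by_cases hb : (r.1, r.2.1) = (r'.1, r'.2.1)
  · rw [Prod.mk.injEq] at hb
    exact hrr (circulantIndex_row_eq h hb.1 hb.2)
  · refine hC _ _ ⟨hb, (t, t'), Finset.mk_mem_product ht ht', ?_⟩ hCC
    simp only [circulantIndex, Prod.mk.injEq] at h
    exact ⟨h.1, h.2.1⟩

/-- Give each set `T` the weight `(s/N)^|T|`. The total is `(1 + s/N)^N ≤ e^s`, and every set
counted weighs at least `(s/N)^s`. -/
lemma card_filter_card_le_le {κ : Type*} [Fintype κ] {s : ℕ} (hs : 1 ≤ s)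
    (hsN : s ≤ Fintype.card κ) :
    (((Finset.univ : Finset (Finset κ)).filter fun T => T.card ≤ s).card : ℝ) ≤
      (Real.exp 1 * Fintype.card κ / s) ^ s := by
  classical
  set N := Fintype.card κ
  have hs0 : (0 : ℝ) < s := by positivity
  have hN0 : (0 : ℝ) < N := by
    have : 1 ≤ N := hs.trans hsN
    positivity
  have hsN' : (s : ℝ) ≤ N := by exact_mod_cast hsN
  have hle1 : (s / N : ℝ) ≤ 1 := (div_le_one hN0).2 hsN'
  have hsum : ∑ T : Finset κ, (s / N : ℝ) ^ T.card = (s / N + 1) ^ N := by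
    have := Fintype.sum_pow_mul_eq_add_pow κ (s / N : ℝ) 1
    simpa using this
  have h1 : (((Finset.univ : Finset (Finset κ)).filter fun T => T.card ≤ s).card : ℝ) *
      (s / N : ℝ) ^ s ≤ (s / N + 1) ^ N := by
    rw [← hsum, ← nsmul_eq_mul, ← Finset.sum_const]
    refine (Finset.sum_le_sum fun T hT => ?_).trans
      (Finset.sum_le_sum_of_subset_of_nonneg (Finset.filter_subset _ _)
        fun _ _ _ => by positivity)
    exact pow_le_pow_of_le_one (by positivity) hle1 (Finset.mem_filter.1 hT).2
  have h2 : (s / N + 1 : ℝ) ^ N ≤ Real.exp 1 ^ s := by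
    calc (s / N + 1 : ℝ) ^ N ≤ Real.exp (s / N) ^ N := by
          gcongr; exact Real.add_one_le_exp _
      _ = Real.exp 1 ^ s := by
          rw [← Real.exp_nat_mul, ← Real.exp_nat_mul]
          congr 1
          field_simp
  have h3 : (Real.exp 1 * N / s : ℝ) ^ s * (s / N : ℝ) ^ s = Real.exp 1 ^ s := by
    rw [← mul_pow]
    congr 1
    field_simp
  refine le_of_mul_le_mul_right ?_ (by positivity : (0 : ℝ) < (s / N : ℝ) ^ s)
  rw [h3]
  exact h1.trans h2

/-! ### From a fixed vector to all sparse vectors -/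

section RestrictedIsometry

variable {Ω Q R κ : Type*} [MeasurableSpace Ω] {P : Measure Ω} [IsProbabilityMeasure P]
  [Finite Q] [Fintype R] {D : EntryDist} {X : Q → Ω → ℝ} {idx : R → κ → Q}

/-- Concentration of `‖A z‖²` for a fixed vector `z` supported on the columns `T`, when the rows can
be coloured with `q` colours so that rows of equal colour share no variable on `T`. -/
lemma measure_norm_sq_deviation_le [Nonempty R]
    (hX : ∀ p, HasLaw (X p) (D.law (Fintype.card R)) P)
    (hind : iIndepFun X P) (hidx : ∀ r, Function.Injective (idx r)) (T : Finset κ) {q : ℕ}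
    (C : R → Fin q)
    (hC : ∀ r r', r ≠ r' → C r = C r' → ∀ t ∈ T, ∀ t' ∈ T, idx r t ≠ idx r' t')
    {η : ℝ} (hη : 0 < η) (hη1 : η ≤ 1) (z : EuclideanSpace ℝ T) :
    P {ω | η * ‖z‖ ^ 2 < |‖WithLp.toLp 2 (((Matrix.of fun r c => X (idx r c) ω).submatrix id
      (Subtype.val : T → κ)).mulVec z.ofLp)‖ ^ 2 - ‖z‖ ^ 2|} ≤
      2 * ENNReal.ofReal (Real.exp (-(η ^ 2 / 9216 * (Fintype.card R / q)))) := by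
  classical
  rcases eq_or_ne z 0 with rfl | hz
  · simp
  have hn : Fintype.card R ≠ 0 := Fintype.card_ne_zero
  have hq : q ≠ 0 := by
    rintro rfl
    exact (C (Classical.arbitrary R)).elim0
  have hz2 : 0 < ‖z‖ ^ 2 := by positivity
  have hn0 : (0 : ℝ) < Fintype.card R := by positivity
  set n := Fintype.card R with hndef
  -- Rescaling `z` to squared length `n` gives each row form unit variance.
  set a : T → ℝ := fun t => √n / ‖z‖ * z t with ha_def
  have ha : ∑ t, a t ^ 2 = n := by
    simp only [ha_def, mul_pow, div_pow, Real.sq_sqrt hn0.le]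
    rw [← Finset.mul_sum, ← EuclideanSpace.real_norm_sq_eq]
    field_simp
  have hidx' : ∀ r, Function.Injective fun t : T => idx r t := fun r =>
    (hidx r).comp Subtype.val_injective
  have hsub := fun r => hasSubgaussianMGF_sum_mul_of_hasLaw hn hX hind (hidx' r) ha
  have hsq := fun r => integral_sq_sum_mul_of_hasLaw hn hX hind (hidx' r) ha
  set V : R → Ω → ℝ := fun r ω => (∑ t, a t * X (idx r t) ω) ^ 2 - 1 with hV_def
  have hVm : ∀ r, AEMeasurable (V r) P := fun r =>
    ((hsub r).aemeasurable.pow_const 2).sub_const 1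
  have hprod : ∀ (g : Fin q) (θ : ℝ),
      ∫⁻ ω, ∏ r with C r = g, ENNReal.ofReal (Real.exp (θ * V r ω)) ∂P =
        ∏ r with C r = g, ∫⁻ ω, ENNReal.ofReal (Real.exp (θ * V r ω)) ∂P := by
    intro g θ
    refine lintegral_prod_eq_prod_lintegral_of_dependsOn hind (fun p => (hX p).aemeasurable)
      (fun r => T.image (idx r))
      (fun r x => ENNReal.ofReal (Real.exp (θ * ((∑ t : T, a t * x (idx r t)) ^ 2 - 1))))
      (fun r => by fun_prop) ?_ _ ?_
    · intro r x y hxy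
      have : ∀ t : T, x (idx r t) = y (idx r t) := fun t =>
        hxy _ (Finset.mem_coe.2 (Finset.mem_image_of_mem _ t.2))
      simp only [this]
    · intro r hr r' hr' hrr
      have hr := (Finset.mem_filter.1 (Finset.mem_coe.1 hr)).2
      have hr' := (Finset.mem_filter.1 (Finset.mem_coe.1 hr')).2
      refine Finset.disjoint_left.2 fun p hp hp' => ?_
      obtain ⟨t, ht, rfl⟩ := Finset.mem_image.1 hp
      obtain ⟨t', ht', h⟩ := Finset.mem_image.1 hp'
      exact hC r r' hrr (hr.trans hr'.symm) t ht t' ht' h.symm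
  have htail := measure_abs_sum_ge_le_of_coloring hq C hVm hprod
    (fun r θ hθ => (hsub r).lintegral_exp_mul_sq_sub_one_le (hsq r) hθ) hη hη1
  refine (measure_mono fun ω hω => ?_).trans htail
  have hω : η * ‖z‖ ^ 2 < |‖WithLp.toLp 2 (((Matrix.of fun r c => X (idx r c) ω).submatrix id
      (Subtype.val : T → κ)).mulVec z.ofLp)‖ ^ 2 - ‖z‖ ^ 2| := hω
  have hkey : ‖WithLp.toLp 2 (((Matrix.of fun r c => X (idx r c) ω).submatrix id
      (Subtype.val : T → κ)).mulVec z.ofLp)‖ ^ 2 - ‖z‖ ^ 2 = ‖z‖ ^ 2 / n * ∑ r, V r ω := by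
    have hrow : ∀ r, ∑ t : T, a t * X (idx r t) ω =
        √n / ‖z‖ * ∑ t : T, X (idx r t) ω * z t := by
      intro r
      rw [Finset.mul_sum]
      exact Finset.sum_congr rfl fun t _ => by simp only [ha_def]; ring
    have hs : ∑ r, V r ω = n / ‖z‖ ^ 2 * (∑ r, (∑ t : T, X (idx r t) ω * z t) ^ 2) - n := by
      simp only [hV_def, Finset.sum_sub_distrib, hrow, mul_pow, div_pow, Real.sq_sqrt hn0.le,
        ← Finset.mul_sum]
      simp [hndef]
    rw [hs, EuclideanSpace.real_norm_sq_eq]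
    simp only [Matrix.mulVec, dotProduct, Matrix.submatrix_apply, Matrix.of_apply, id]
    field_simp
  rw [hkey, abs_mul, abs_of_pos (by positivity)] at hω
  show η * n ≤ |∑ r, V r ω|
  have h1 : ‖z‖ ^ 2 / n * (η * n) < ‖z‖ ^ 2 / n * |∑ r, V r ω| := by
    calc ‖z‖ ^ 2 / n * (η * n) = η * ‖z‖ ^ 2 := by field_simp
      _ < _ := hω
  exact (lt_of_mul_lt_mul_left h1 (by positivity)).le

/-- Union bound over supports and nets for the failure of the restricted isometry property. -/
lemma measure_not_satisfiesRIP_le [Nonempty R] [Fintype κ]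
    (hX : ∀ p, HasLaw (X p) (D.law (Fintype.card R)) P)
    (hind : iIndepFun X P) (hidx : ∀ r, Function.Injective (idx r)) {s q : ℕ} (hs : 1 ≤ s)
    (hsN : s ≤ Fintype.card κ)
    (hC : ∀ T : Finset κ, T.card ≤ s → ∃ C : R → Fin q, ∀ r r', r ≠ r' → C r = C r' →
      ∀ t ∈ T, ∀ t' ∈ T, idx r t ≠ idx r' t')
    {δ : ℝ} (hδ : 0 < δ) (hδ1 : δ < 1) :
    P {ω | ¬ SatisfiesRIP (Matrix.of fun r c => X (idx r c) ω) s δ} ≤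
      ENNReal.ofReal ((Real.exp 1 * Fintype.card κ / s) ^ s * 25 ^ s *
        (2 * Real.exp (-(δ ^ 2 / 147456 * (Fintype.card R / q))))) := by
  classical
  choose net hcard hnet using fun T : Finset κ => exists_quarter_net (EuclideanSpace ℝ T)
  set ε : ℝ := 2 * Real.exp (-(δ ^ 2 / 147456 * (Fintype.card R / q))) with hε
  -- Tolerance `δ / 4`, since passing from the net to the whole space costs a factor `4`; hence
  -- `147456 = 16 * 9216`.
  let bad (T : Finset κ) (z : EuclideanSpace ℝ T) : Set Ω :=
    {ω | δ / 4 * ‖z‖ ^ 2 < |‖WithLp.toLp 2 (((Matrix.of fun r c => X (idx r c) ω).submatrix id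
      (Subtype.val : T → κ)).mulVec z.ofLp)‖ ^ 2 - ‖z‖ ^ 2|}
  set F := (Finset.univ : Finset (Finset κ)).filter fun T => T.card ≤ s with hF
  have hsub : {ω | ¬ SatisfiesRIP (Matrix.of fun r c => X (idx r c) ω) s δ} ⊆
      ⋃ T ∈ F, ⋃ z ∈ net T, bad T z := by
    intro ω hω
    by_contra hcon
    refine hω fun T hT x => ?_
    have hgood : ∀ z ∈ net T, ω ∉ bad T z := fun z hz hbad => hcon <|
      Set.mem_biUnion (show T ∈ F by simpa [hF] using hT) (Set.mem_biUnion hz hbad)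
    have h := abs_norm_sq_sub_le_of_net
      (Matrix.toLpLin 2 2 ((Matrix.of fun r c => X (idx r c) ω).submatrix id
        (Subtype.val : T → κ))) (hnet T) (by positivity : 0 ≤ δ / 4)
      (fun z hz => not_lt.1 (hgood z hz)) x
    rw [Matrix.toLpLin_apply, abs_le] at h
    constructor <;> linarith [h.1, h.2]
  have hbad : ∀ T ∈ F, ∀ z ∈ net T, P (bad T z) ≤ ENNReal.ofReal ε := by
    intro T hT z _
    obtain ⟨C, hCT⟩ := hC T (Finset.mem_filter.1 hT).2
    refine (measure_norm_sq_deviation_le hX hind hidx T C hCT (by positivity : 0 < δ / 4)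
      (by linarith) z).trans (le_of_eq ?_)
    rw [hε, ENNReal.ofReal_mul (by norm_num), ENNReal.ofReal_ofNat]
    congr 4
    ring
  have hnetcard : ∀ T ∈ F, ((net T).card : ℝ) ≤ 25 ^ s := by
    intro T hT
    have h1 := hcard T
    rw [finrank_euclideanSpace, Fintype.card_coe] at h1
    exact_mod_cast h1.trans (Nat.pow_le_pow_right (by norm_num) (Finset.mem_filter.1 hT).2)
  have hε0 : 0 ≤ ε := by positivity
  calc P {ω | ¬ SatisfiesRIP (Matrix.of fun r c => X (idx r c) ω) s δ}
      ≤ P (⋃ T ∈ F, ⋃ z ∈ net T, bad T z) := measure_mono hsub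
    _ ≤ ∑ T ∈ F, P (⋃ z ∈ net T, bad T z) := measure_biUnion_finset_le _ _
    _ ≤ ∑ T ∈ F, ENNReal.ofReal (25 ^ s * ε) := by
        refine Finset.sum_le_sum fun T hT => (measure_biUnion_finset_le _ _).trans ?_
        refine (Finset.sum_le_sum (hbad T hT)).trans ?_
        rw [Finset.sum_const, ← ENNReal.ofReal_nsmul, nsmul_eq_mul]
        exact ENNReal.ofReal_le_ofReal (mul_le_mul_of_nonneg_right (hnetcard T hT) hε0)
    _ ≤ _ := by
        rw [Finset.sum_const, ← ENNReal.ofReal_nsmul, nsmul_eq_mul, mul_assoc]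
        exact ENNReal.ofReal_le_ofReal
          (mul_le_mul_of_nonneg_right (card_filter_card_le_le hs hsN) (by positivity))

end RestrictedIsometry

/-! ### Choice of constants and conclusion -/

lemma union_bound_le_exp {m N : ℕ} (hm : 1 ≤ m) (hN : 3 * m ≤ N) {x : ℝ}
    (hx : 32 * (m * Real.log (N / m)) ≤ x) :
    (Real.exp 1 * N / (3 * m : ℕ)) ^ (3 * m) * 25 ^ (3 * m) * (2 * Real.exp (-x)) ≤
      Real.exp (-(x / 2)) := by
  have hm0 : (1 : ℝ) ≤ m := by exact_mod_cast hm
  have hN' : (3 : ℝ) * m ≤ N := by exact_mod_cast hN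
  have h3 : (3 : ℝ) ≤ N / m := by rw [le_div_iff₀ (by linarith)]; exact hN'
  set L := Real.log (N / m)
  have hexpL : Real.exp L = N / m := Real.exp_log (by linarith)
  have hexp1 : Real.exp 1 ≤ 3 := by linarith [Real.exp_one_lt_d9]
  have hL : 1 ≤ L := by
    rw [Real.le_log_iff_exp_le (by linarith)]
    linarith
  have h1 : Real.exp 1 * N / (3 * m : ℕ) ≤ Real.exp L := by
    rw [hexpL]
    push_cast
    rw [div_le_div_iff₀ (by linarith) (by linarith)]
    have : (0 : ℝ) ≤ N * m := by positivity
    nlinarith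
  have h25 : (25 : ℝ) ≤ Real.exp 4 := by
    have h := Real.exp_one_gt_d9
    have : Real.exp 4 = Real.exp 1 ^ 4 := by rw [← Real.exp_nat_mul]; norm_num
    rw [this]
    calc (25 : ℝ) ≤ 2.7 ^ 4 := by norm_num
      _ ≤ _ := by gcongr; linarith
  have h2 : (2 : ℝ) ≤ Real.exp 1 := by linarith [Real.exp_one_gt_d9]
  calc (Real.exp 1 * N / (3 * m : ℕ)) ^ (3 * m) * 25 ^ (3 * m) * (2 * Real.exp (-x))
      ≤ Real.exp L ^ (3 * m) * Real.exp 4 ^ (3 * m) * (Real.exp 1 * Real.exp (-x)) := by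
        gcongr
    _ = Real.exp (3 * m * L + 3 * m * 4 + (1 - x)) := by
        rw [← Real.exp_nat_mul, ← Real.exp_nat_mul, ← Real.exp_add, ← Real.exp_add,
          ← Real.exp_add]
        congr 1
        push_cast
        ring
    -- As `L ≥ 1`, the entropy `3mL + 12m + 1` is at most `16 mL ≤ x / 2`; this is the origin of
    -- `32`.
    _ ≤ _ := by
        apply Real.exp_le_exp.2
        have hmL : (m : ℝ) ≤ m * L := by nlinarith
        nlinarith

/-- The common core of both regimes, which differ only in the number `q` of colours. -/
lemma one_sub_exp_le_measureReal_satisfiesRIP {δ : ℝ} (hδ : δ ∈ Set.Ioo (0 : ℝ) 1)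
    {m l₁ k₁ l₂ k₂ d e q : ℕ} (hm : 1 ≤ m) (hN : 3 * m ≤ k₁ * k₂ * e) (hn : l₁ * l₂ * d ≠ 0)
    {D : EntryDist} {Ω : Type*} [MeasurableSpace Ω] {P : Measure Ω} [IsProbabilityMeasure P]
    {Υ : ZMod k₁ → ZMod k₂ → Ω → Matrix (Fin d) (Fin e) ℝ}
    (hlaw : ∀ i j a b, HasLaw (fun ω => Υ i j ω a b) (D.law (l₁ * l₂ * d)) P)
    (hind : iIndepFun (fun (p : ZMod k₁ × ZMod k₂ × Fin d × Fin e) (ω : Ω) =>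
      Υ p.1 p.2.1 ω p.2.2.1 p.2.2.2) P)
    (hC : ∀ T : Finset (Fin k₁ × Fin k₂ × Fin e), T.card ≤ 3 * m →
      ∃ C : Fin l₁ × Fin l₂ × Fin d → Fin q, ∀ r r', r ≠ r' → C r = C r' →
        ∀ t ∈ T, ∀ t' ∈ T, circulantIndex r t ≠ circulantIndex r' t')
    (hq : 32 * (m * Real.log ((k₁ * k₂ * e : ℕ) / m)) ≤
      δ ^ 2 / 147456 * ((l₁ * l₂ * d : ℕ) / q)) :
    1 - Real.exp (-(δ ^ 2 / 147456 * ((l₁ * l₂ * d : ℕ) / q) / 2)) ≤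
      P.real {ω | SatisfiesRIP
        (circulantBlock l₁ k₁ fun i => circulantBlock l₂ k₂ fun j => Υ i j ω) (3 * m) δ} := by
  have hN0 : k₁ * k₂ * e ≠ 0 := by omega
  have : NeZero k₁ := ⟨by rintro rfl; simp at hN0⟩
  have : NeZero k₂ := ⟨by rintro rfl; simp at hN0⟩
  have hcardR : Fintype.card (Fin l₁ × Fin l₂ × Fin d) = l₁ * l₂ * d := by simp [mul_assoc]
  have hcardκ : Fintype.card (Fin k₁ × Fin k₂ × Fin e) = k₁ * k₂ * e := by simp [mul_assoc]
  have : Nonempty (Fin l₁ × Fin l₂ × Fin d) :=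
    Fintype.card_pos_iff.1 (by rw [hcardR]; omega)
  have h := measure_not_satisfiesRIP_le (D := D) (P := P) (s := 3 * m) (q := q)
    (X := fun (p : ZMod k₁ × ZMod k₂ × Fin d × Fin e) (ω : Ω) => Υ p.1 p.2.1 ω p.2.2.1 p.2.2.2)
    (idx := circulantIndex (l₁ := l₁) (l₂ := l₂))
    (fun p => by rw [hcardR]; exact hlaw _ _ _ _) hind
    (fun r => circulantIndex_injective r) (by omega) (by rw [hcardκ]; exact hN) hC hδ.1 hδ.2
  rw [hcardR, hcardκ] at h
  set S := {ω | SatisfiesRIP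
    (circulantBlock l₁ k₁ fun i => circulantBlock l₂ k₂ fun j => Υ i j ω) (3 * m) δ} with hS
  have hbad : P Sᶜ ≤ ENNReal.ofReal
      (Real.exp (-(δ ^ 2 / 147456 * ((l₁ * l₂ * d : ℕ) / q) / 2))) :=
    le_trans h (ENNReal.ofReal_le_ofReal (union_bound_le_exp hm hN hq))
  have hbad' : P.real Sᶜ ≤ Real.exp (-(δ ^ 2 / 147456 * ((l₁ * l₂ * d : ℕ) / q) / 2)) :=
    ENNReal.toReal_le_of_le_ofReal (Real.exp_pos _).le hbad
  have hun : (1 : ℝ) ≤ P.real S + P.real Sᶜ := by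
    have := measureReal_union_le (μ := P) S Sᶜ
    rwa [Set.union_compl_self, probReal_univ] at this
  linarith

theorem mainTheorem3 (δ : ℝ) (hδ : δ ∈ Set.Ioo (0 : ℝ) 1) :
    ∃ c₁ > (0 : ℝ), ∃ c₂ > (0 : ℝ),
      ∀ (m l₁ k₁ l₂ k₂ d e n N : ℕ),
        1 ≤ m → 1 ≤ l₁ → l₁ ≤ k₁ → 1 ≤ l₂ → l₂ ≤ k₂ →
        n = l₁ * l₂ * d → N = k₁ * k₂ * e → 3 * m ≤ N →
      ∀ (D : EntryDist) (Ω : Type*) [MeasurableSpace Ω] (P : Measure Ω) [IsProbabilityMeasure P]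
        (Υ : ZMod k₁ → ZMod k₂ → Ω → Matrix (Fin d) (Fin e) ℝ),
        (∀ i j a b, HasLaw (fun ω => Υ i j ω a b) (D.law n) P) →
        iIndepFun (fun (q : ZMod k₁ × ZMod k₂ × Fin d × Fin e) (ω : Ω) =>
          Υ q.1 q.2.1 ω q.2.2.1 q.2.2.2) P →
        (l₁ * l₂ ≤ 3 * m * (3 * m - 1) →
          c₁ * (l₁ * l₂) * m * Real.log (N / m) ≤ n →
          1 - Real.exp (-(c₂ * n / (l₁ * l₂))) ≤
            P.real {ω | SatisfiesRIP
              (circulantBlock l₁ k₁ fun i => circulantBlock l₂ k₂ fun j => Υ i j ω)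
              (3 * m) δ}) ∧
        (3 * m * (3 * m - 1) < l₁ * l₂ →
          c₁ * m ^ 3 * Real.log (N / m) ≤ n →
          1 - Real.exp (-(c₂ * n / m ^ 2)) ≤
            P.real {ω | SatisfiesRIP
              (circulantBlock l₁ k₁ fun i => circulantBlock l₂ k₂ fun j => Υ i j ω)
              (3 * m) δ}) := by
  have hδ0 : 0 < δ := hδ.1
  set c : ℝ := δ ^ 2 / 147456 with hc
  have hc0 : 0 < c := by positivity
  -- The second regime dictates both: `q ≤ 9m²` turns the factor `32` into `288 = 9 * 32` and the
  -- rate `c / 2` into `c / 18`. The first regime has room to spare.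
  refine ⟨288 / c, by positivity, c / 18, by positivity, ?_⟩
  intro m l₁ k₁ l₂ k₂ d e n N hm hl₁ hlk₁ hl₂ hlk₂ hn hN hmN D Ω _ P _ Υ hlaw hind
  have hm0 : (1 : ℝ) ≤ m := by exact_mod_cast hm
  have hl : (0 : ℝ) < l₁ * l₂ := by
    have h₁ : (0 : ℝ) < l₁ := by exact_mod_cast hl₁
    have h₂ : (0 : ℝ) < l₂ := by exact_mod_cast hl₂
    positivity
  have hL : 0 < Real.log (N / m) := by
    apply Real.log_pos
    rw [one_lt_div (by linarith)]
    exact_mod_cast (by omega : m < N)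
  constructor
  · intro _ hnc
    have hn0 : n ≠ 0 := by
      rintro rfl
      have : 0 < 288 / c * (l₁ * l₂) * m * Real.log (N / m) := by positivity
      simp at hnc
      linarith
    subst hn hN
    have hk : 288 / c * m * Real.log ((k₁ * k₂ * e : ℕ) / m) ≤
        (l₁ * l₂ * d : ℕ) / ((l₁ * l₂ : ℕ) : ℝ) := by
      rw [Nat.cast_mul l₁ l₂, le_div_iff₀ hl]
      linarith
    have hk' := mul_le_mul_of_nonneg_left hk hc0.le
    have e1 : c * (288 / c * m * Real.log ((k₁ * k₂ * e : ℕ) / m)) =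
        288 * (m * Real.log ((k₁ * k₂ * e : ℕ) / m)) := by field_simp
    rw [e1] at hk'
    have hmL : 0 < m * Real.log ((k₁ * k₂ * e : ℕ) / m) := by positivity
    refine le_trans ?_ (one_sub_exp_le_measureReal_satisfiesRIP hδ hm hmN hn0 hlaw hind
      (fun T _ => exists_row_coloring_by_block T) (by rw [← hc]; linarith))
    rw [sub_le_sub_iff_left]
    apply Real.exp_le_exp.2
    rw [← hc, mul_div_assoc (c / 18), ← Nat.cast_mul l₁ l₂]
    linarith
  · intro _ hnc
    have hn0 : n ≠ 0 := by
      rintro rfl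
      have : 0 < 288 / c * m ^ 3 * Real.log (N / m) := by positivity
      simp at hnc
      linarith
    subst hn hN
    set q : ℕ := 3 * m * (3 * m - 1) + 1 with hq
    have hq9 : (q : ℝ) ≤ 9 * m ^ 2 := by
      have : q ≤ 9 * m ^ 2 := by
        obtain ⟨j, rfl⟩ : ∃ j, m = j + 1 := ⟨m - 1, by omega⟩
        rw [hq, show 3 * (j + 1) - 1 = 3 * j + 2 by omega]
        nlinarith
      exact_mod_cast this
    have hq0 : (0 : ℝ) < q := by positivity
    have hdiv : ((l₁ * l₂ * d : ℕ) : ℝ) / (9 * m ^ 2) ≤ (l₁ * l₂ * d : ℕ) / q := by gcongr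
    have hk : 288 / c * m * Real.log ((k₁ * k₂ * e : ℕ) / m) / 9 ≤
        (l₁ * l₂ * d : ℕ) / (9 * m ^ 2) := by
      rw [div_le_div_iff₀ (by norm_num) (by positivity)]
      nlinarith
    have hk' := mul_le_mul_of_nonneg_left (hk.trans hdiv) hc0.le
    have e1 : c * (288 / c * m * Real.log ((k₁ * k₂ * e : ℕ) / m) / 9) =
        32 * (m * Real.log ((k₁ * k₂ * e : ℕ) / m)) := by field_simp; norm_num
    rw [e1] at hk'
    refine le_trans ?_ (one_sub_exp_le_measureReal_satisfiesRIP hδ hm hmN hn0 hlaw hind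
      (fun T hT => exists_row_coloring_of_card_le hlk₁ hlk₂ T hT) hk')
    rw [sub_le_sub_iff_left]
    apply Real.exp_le_exp.2
    have h2 := mul_le_mul_of_nonneg_left hdiv hc0.le
    have e2 : c / 18 * ((l₁ * l₂ * d : ℕ) : ℝ) / m ^ 2 =
        c * (((l₁ * l₂ * d : ℕ) : ℝ) / (9 * m ^ 2)) / 2 := by field_simp; norm_num
    rw [e2, ← hc, ← hq]
    linarith
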